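/- For $f\in L^2(\mathbb{R})$ (complex-valued) let $\mathcal{G}f(x,y)=\int_{\mathbb{R}} f(t)e^{-\pi(t-x)^2}e^{-2\pi i ty}\,dt$ be its Gabor transform and $\mathcal{S}f=|\mathcal{G}f|^2$ its spectrogram. For $r>0$ and an integer $N\ge 1$, the product Gauss cubature rule of degree $N$ on $Q_r=[-r,r]^2$ has the nodes $(\gamma_k,\gamma_l)$ and weights $\omega_k\omega_l$, $1\le k,l\le N$, where $\gamma_k$ and $\omega_k$ are the nodes and weights of the $N$-point Gauss(-Legendre) quadrature rule on $[-r,r]$; set $$\mathcal{E}^{(N,r)}(\phi)=\iint_{Q_r}\phi\,dx\,dy-\sum_{k,l=1}^N\omega_k\omega_l\,\phi(\gamma_k,\gamma_l).$$ On an arbitrary (possibly rotated) square $Q\subseteq\mathbb{R}^2$ of side length $2r$ set $\mathcal{E}_Q^{(N)}(\phi)=\mathcal{E}^{(N,r)}(\phi\circ T)$, where $T$ is a rotation followed by a translation with $T(Q_r)=Q$. Let $s>0$ and let $Q\subseteq\mathbb{R}^2$ be a square of side length at most $2s$ (for instance, of side length $s$). Then for all integers $N\ge 1$ and all $f,g\in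 L^2(\mathbb{R})$, $$\left|\mathcal{E}_Q^{(N)}\big((\mathcal{S}f-\mathcal{S}g)^2\big)\right|\le 3\left(\sqrt{8\pi}\,s+2\right)^{N+3}N^{-\frac{N-1}{2}}e^{N/2}\left(\|f\|_{L^2(\mathbb{R})}^4+\|g\|_{L^2(\mathbb{R})}^4\right).$$ -/

import Mathlib

open MeasureTheory

noncomputable section

namespace GaborCubature

/-- The Gabor transform `𝒢 f(x, y)`: the Fourier transform
`h ↦ (y ↦ ∫ t, exp(-2πi t y) h(t))` of `t ↦ f(t) exp(-π (t - x)²)`, at frequency `y`. -/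
def gabor (f : Lp ℂ 2 (volume : Measure ℝ)) (p : ℝ × ℝ) : ℂ :=
  FourierTransform.fourier
    (fun t : ℝ => f t * ((Real.exp (-Real.pi * (t - p.1) ^ 2) : ℝ) : ℂ)) p.2

/-- The spectrogram `𝒮 f = |𝒢 f|²`. -/
def spectrogram (f : Lp ℂ 2 (volume : Measure ℝ)) (p : ℝ × ℝ) : ℝ :=
  ‖gabor f p‖ ^ 2

/-- The `N`-th Legendre polynomial on `[-1, 1]` (Rodrigues' formula). -/
def legendre (N : ℕ) : Polynomial ℝ :=
  Polynomial.C ((2 ^ N * (N.factorial : ℝ))⁻¹) *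
    Polynomial.derivative^[N] ((Polynomial.X ^ 2 - 1) ^ N)

/-- The nodes of the `N` point Gauss quadrature rule on `[-s, s]`:
the roots of the `N`-th Legendre polynomial, dilated by `s`. -/
def gaussNodes (N : ℕ) (s : ℝ) : Finset ℝ :=
  (legendre N).roots.toFinset.image (fun t => s * t)

/-- The weight of the `N` point Gauss quadrature rule on `[-s, s]` at the node `γ`:
the integral of the Lagrange basis polynomial at `γ`. -/
def gaussWeight (N : ℕ) (s : ℝ) (γ : ℝ) : ℝ :=
  ∫ x in (-s)..s, (Lagrange.basis (gaussNodes N s) id γ).eval x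

/-- The square `[-s, s]²`. -/
def centeredSquare (s : ℝ) : Set (ℝ × ℝ) :=
  Set.Icc (-s) s ×ˢ Set.Icc (-s) s

/-- The integration error on `[-s, s]²` of the product Gauss cubature rule of degree `N`. -/
def cubatureError (N : ℕ) (s : ℝ) (φ : ℝ × ℝ → ℝ) : ℝ :=
  (∫ p in centeredSquare s, φ p) -
    ∑ l ∈ gaussNodes N s ×ˢ gaussNodes N s,
      φ l * (gaussWeight N s l.1 * gaussWeight N s l.2)

/-- The affine map of the plane that rotates by the angle `θ` and then translates by `c`. -/
def rigidMotion (c : ℝ × ℝ) (θ : ℝ) (p : ℝ × ℝ) : ℝ × ℝ :=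
  (c.1 + (Real.cos θ * p.1 - Real.sin θ * p.2),
   c.2 + (Real.sin θ * p.1 + Real.cos θ * p.2))

/-- The integration error of the product Gauss cubature rule of degree `N` on the square
`rigidMotion c θ '' centeredSquare r` (centre `c`, side length `2 * r`, rotated by `θ`): the
function is pulled back to `[-r, r]²` by an affine map of determinant one. Every closed square of
side length `2 * r` in the plane is of this form. -/
def squareCubatureError (N : ℕ) (r : ℝ) (c : ℝ × ℝ) (θ : ℝ) (φ : ℝ × ℝ → ℝ) : ℝ :=
  cubatureError N r (φ ∘ rigidMotion c θ)

end GaborCubature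

end

/-! Completing the square turns the Gabor transform into a Gaussian times the Bargmann transform,
which is entire. Hence along any line `t ↦ a + t • v` with `v` a unit vector, the spectrogram
extends to the entire function `F z * conj (F (conj z))`, where `F` is the extended Gabor transform
on that line. Its modulus is at most `‖f‖² exp(2π (im z)²)`, whatever the line. With `K = ‖f‖⁴ +
‖g‖⁴`, the extension of `(𝒮 f - 𝒮 g)²` is then at most `2 K exp(4π R²)` on the circle `|z| = R`, and
Cauchy's estimates bound the error of its Taylor polynomial of degree less than `N` on `[-s, s]` by
`2 K exp(4π R²) (s/R)^N / (1 - s/R)` (`exists_polynomial_near_spectrogram`).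

Gauss weights are nonnegative with sum `2r` on `[-r, r]`, and the rule is exact in degree less than
`N`. An approximation within `ε` along both side directions therefore gives a cubature error of at
most `16 r² ε` (`abs_cubatureError_le`). Since the growth bound is the same for every line, rotation
and translation cost nothing.

The radius `R² = N/(8π)` minimises `exp(4π R²) R^(-N)` and produces `e^(N/2) N^(-N/2)`. When `N` is
too small for this radius to be useful, the sup bound on `(𝒮 f - 𝒮 g)²` suffices. -/

noncomputable section

namespace GaborCubature

/-! ### Legendre polynomials: orthogonality and roots -/

open Polynomial in
/-- A nonzero polynomial that is nonnegative on `[-1, 1]` has positive integral. -/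
lemma integral_eval_pos {p : ℝ[X]} (hp : p ≠ 0)
    (hnn : ∀ x ∈ Set.Icc (-1 : ℝ) 1, 0 ≤ p.eval x) : 0 < ∫ x in (-1 : ℝ)..1, p.eval x := by
  refine intervalIntegral.integral_pos (by norm_num) p.continuous.continuousOn
    (fun x hx => hnn x ⟨hx.1.le, hx.2⟩) ?_
  by_contra! h
  refine hp (Polynomial.eq_zero_of_infinite_isRoot p
    ((Set.Icc_infinite (show (-1 : ℝ) < 1 by norm_num)).mono fun x hx => ?_))
  exact le_antisymm (h x hx) (hnn x hx)

-- Fewer than `N` derivatives leave a factor `X ^ 2 - 1`; this removes the boundary terms when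
-- integrating by parts.
open Polynomial in
lemma eval_iterate_derivative_eq_zero {N k : ℕ} (hk : k < N) {a : ℝ} (ha : a ^ 2 = 1) :
    (derivative^[k] ((X ^ 2 - 1 : ℝ[X]) ^ N)).eval a = 0 := by
  obtain ⟨q, hq⟩ := pow_sub_dvd_iterate_derivative_pow (X ^ 2 - 1 : ℝ[X]) N k
  have : N - k ≠ 0 := by omega
  simp [hq, ha, this]

open Polynomial in
/-- Integration by parts against the derivatives of `(X ^ 2 - 1) ^ N`. -/
lemma integral_iterate_derivative_mul_eq_zero {N k : ℕ} (hk : k ≤ N) (q : ℝ[X])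
    (hq : derivative^[k] q = 0) :
    ∫ x in (-1 : ℝ)..1, (derivative^[k] ((X ^ 2 - 1 : ℝ[X]) ^ N)).eval x * q.eval x = 0 := by
  induction k generalizing q with
  | zero =>
    have : q = 0 := hq
    simp [this]
  | succ k ih =>
    have h := intervalIntegral.integral_deriv_mul_eq_sub (a := (-1 : ℝ)) (b := 1)
      (u := fun x => (derivative^[k] ((X ^ 2 - 1 : ℝ[X]) ^ N)).eval x) (v := fun x => q.eval x)
      (fun x _ => Polynomial.hasDerivAt _ x) (fun x _ => Polynomial.hasDerivAt _ x)
      ((Polynomial.continuous _).intervalIntegrable _ _)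
      ((Polynomial.continuous _).intervalIntegrable _ _)
    have e1 := eval_iterate_derivative_eq_zero (N := N) (k := k) (by omega) (a := 1) (by norm_num)
    have e2 := eval_iterate_derivative_eq_zero (N := N) (k := k) (by omega) (a := -1) (by norm_num)
    rw [e1, e2, intervalIntegral.integral_add (Continuous.intervalIntegrable (by fun_prop) _ _)
      (Continuous.intervalIntegrable (by fun_prop) _ _),
      ih (by omega) (derivative q) (by simpa using hq)] at h
    simpa only [Function.iterate_succ_apply', zero_mul, sub_zero, add_zero] using h

open Polynomial in
/-- The Legendre polynomial is orthogonal to all polynomials of smaller degree. -/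
lemma integral_legendre_mul_eq_zero {N : ℕ} {q : ℝ[X]} (hq : q.natDegree < N) :
    ∫ x in (-1 : ℝ)..1, (legendre N * q).eval x = 0 := by
  have h := integral_iterate_derivative_mul_eq_zero le_rfl q (iterate_derivative_eq_zero hq)
  simp only [legendre, eval_mul, eval_C, mul_assoc, intervalIntegral.integral_const_mul, h,
    mul_zero]

open Polynomial in
lemma natDegree_X_sq_sub_one_pow (N : ℕ) : ((X ^ 2 - 1 : ℝ[X]) ^ N).natDegree = 2 * N := by
  have : (X ^ 2 - 1 : ℝ[X]).natDegree = 2 := by compute_degree!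
  rw [natDegree_pow, this, mul_comm]

open Polynomial in
lemma X_sq_sub_one_pow_monic (N : ℕ) : ((X ^ 2 - 1 : ℝ[X]) ^ N).Monic := by
  have : (X ^ 2 - 1 : ℝ[X]).Monic := by monicity!
  exact this.pow N

open Polynomial in
lemma coeff_legendre_self_ne_zero (N : ℕ) : (legendre N).coeff N ≠ 0 := by
  have h1 : ((X ^ 2 - 1 : ℝ[X]) ^ N).coeff (N + N) = 1 := by
    have := (X_sq_sub_one_pow_monic N).coeff_natDegree
    rwa [natDegree_X_sq_sub_one_pow, two_mul] at this
  rw [legendre, coeff_C_mul, coeff_iterate_derivative, h1]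
  have : (N + N).descFactorial N ≠ 0 := by
    rw [Ne, Nat.descFactorial_eq_zero_iff_lt]; omega
  simp [this, Nat.factorial_ne_zero]

lemma legendre_ne_zero (N : ℕ) : legendre N ≠ 0 := fun h =>
  coeff_legendre_self_ne_zero N (by simp [h])

open Polynomial in
lemma natDegree_legendre (N : ℕ) : (legendre N).natDegree = N := by
  refine le_antisymm ?_ (le_natDegree_of_ne_zero (coeff_legendre_self_ne_zero N))
  refine (natDegree_C_mul_le _ _).trans ((natDegree_iterate_derivative _ _).trans ?_)
  rw [natDegree_X_sq_sub_one_pow]; omega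

open Polynomial in
/-- Rolle's theorem, iterated: the Legendre polynomial has only real roots. -/
lemma card_roots_legendre (N : ℕ) : (legendre N).roots.card = N := by
  refine le_antisymm ((card_roots' _).trans (natDegree_legendre N).le) ?_
  have h0 : ((X ^ 2 - 1 : ℝ[X]) ^ N).roots.card = 2 * N := by
    have : (X ^ 2 - 1 : ℝ[X]) = (X - C 1) * (X - C (-1)) := by simp; ring
    rw [this, mul_pow, roots_mul (mul_ne_zero (pow_ne_zero _ (X_sub_C_ne_zero _))
      (pow_ne_zero _ (X_sub_C_ne_zero _)))]
    rw [roots_pow, roots_pow, roots_X_sub_C, roots_X_sub_C]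
    simp [two_mul]
  have h1 (k : ℕ) : 2 * N ≤ (derivative^[k] ((X ^ 2 - 1 : ℝ[X]) ^ N)).roots.card + k := by
    induction k with
    | zero => exact h0.ge
    | succ k ih =>
      rw [Function.iterate_succ_apply']
      have := card_roots_le_derivative (derivative^[k] ((X ^ 2 - 1 : ℝ[X]) ^ N))
      omega
  have := h1 N
  rw [legendre, roots_C_mul _ (by positivity)]
  omega

open Polynomial in
lemma legendre_eq_prod (N : ℕ) :
    legendre N = C (legendre N).leadingCoeff * ((legendre N).roots.map fun a => X - C a).prod :=
  (C_leadingCoeff_mul_prod_multiset_X_sub_C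
    (by rw [card_roots_legendre, natDegree_legendre])).symm

-- If `a` were a double root, with `legendre N = (X - a)² q`, then `legendre N * q` would be a
-- nonzero square with integral zero by orthogonality.
open Polynomial in
lemma nodup_roots_legendre (N : ℕ) : (legendre N).roots.Nodup := by
  refine Multiset.nodup_iff_count_le_one.2 fun a => ?_
  by_contra! h
  rw [count_roots] at h
  obtain ⟨q, hq⟩ : (X - C a) ^ 2 ∣ legendre N :=
    (le_rootMultiplicity_iff (legendre_ne_zero N)).1 h
  have hq0 : q ≠ 0 := by
    rintro rfl
    exact legendre_ne_zero N (by simp [hq])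
  have hdeg : q.natDegree < N := by
    have := natDegree_legendre N
    rw [hq, natDegree_mul (pow_ne_zero _ (X_sub_C_ne_zero _)) hq0, natDegree_pow,
      natDegree_X_sub_C] at this
    omega
  have h1 := integral_legendre_mul_eq_zero hdeg
  have h2 : legendre N * q = ((X - C a) * q) ^ 2 := by rw [hq]; ring
  rw [h2] at h1
  refine (integral_eval_pos (p := ((X - C a) * q) ^ 2)
    (pow_ne_zero _ (mul_ne_zero (X_sub_C_ne_zero _) hq0)) fun x _ => ?_).ne' h1
  rw [eval_pow]
  positivity

-- Write `legendre N = (X - a) q`. If `a` lay outside `[-1, 1]`, then `legendre N * q = (X - a) q²`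
-- would have constant sign there, against orthogonality to `q`.
open Polynomial in
lemma mem_Icc_of_mem_roots_legendre {N : ℕ} {a : ℝ} (ha : a ∈ (legendre N).roots) :
    a ∈ Set.Icc (-1 : ℝ) 1 := by
  obtain ⟨q, hq⟩ : (X - C a) ∣ legendre N := dvd_iff_isRoot.2 (isRoot_of_mem_roots ha)
  have hq0 : q ≠ 0 := by
    rintro rfl
    exact legendre_ne_zero N (by simp [hq])
  have hdeg : q.natDegree < N := by
    have := natDegree_legendre N
    rw [hq, natDegree_mul (X_sub_C_ne_zero _) hq0, natDegree_X_sub_C] at this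
    omega
  have h1 := integral_legendre_mul_eq_zero hdeg
  have h2 : legendre N * q = (X - C a) * q ^ 2 := by rw [hq]; ring
  have h3 : (X - C a) * q ^ 2 ≠ 0 := mul_ne_zero (X_sub_C_ne_zero _) (pow_ne_zero _ hq0)
  rw [h2] at h1
  constructor
  · by_contra! h
    refine (integral_eval_pos h3 fun x hx => ?_).ne' h1
    have : 0 ≤ x - a := by linarith [hx.1]
    simp only [eval_mul, eval_sub, eval_X, eval_C, eval_pow]
    positivity
  · by_contra! h
    refine (integral_eval_pos (neg_ne_zero.2 h3) fun x hx => ?_).ne' (by simpa using h1)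
    have : 0 ≤ a - x := by linarith [hx.2]
    have : -((X - C a) * q ^ 2).eval x = (a - x) * q.eval x ^ 2 := by simp; ring
    rw [eval_neg, this]
    positivity

/-! ### Gauss quadrature: nodes, weights and exactness -/

lemma card_gaussNodes (N : ℕ) {s : ℝ} (hs : 0 < s) : (gaussNodes N s).card = N := by
  rw [gaussNodes, Finset.card_image_of_injective _ (mul_right_injective₀ hs.ne'),
    Multiset.toFinset_card_of_nodup (nodup_roots_legendre N), card_roots_legendre]

lemma mem_Icc_of_mem_gaussNodes {N : ℕ} {s γ : ℝ} (hs : 0 < s) (hγ : γ ∈ gaussNodes N s) :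
    γ ∈ Set.Icc (-s) s := by
  obtain ⟨t, ht, rfl⟩ := Finset.mem_image.1 hγ
  have := mem_Icc_of_mem_roots_legendre (Multiset.mem_toFinset.1 ht)
  constructor <;> nlinarith [this.1, this.2]

open Polynomial in
lemma legendre_dvd {N : ℕ} {p : ℝ[X]} (hp : ∀ a ∈ (legendre N).roots, p.eval a = 0) :
    legendre N ∣ p := by
  rcases eq_or_ne p 0 with rfl | hp0
  · exact dvd_zero _
  rw [legendre_eq_prod]
  refine (IsUnit.mul_left_dvd (isUnit_C.2 ?_)).2 ?_
  · exact (leadingCoeff_ne_zero.2 (legendre_ne_zero N)).isUnit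
  · rw [Multiset.prod_X_sub_C_dvd_iff_le_roots hp0,
      Multiset.le_iff_subset (nodup_roots_legendre N)]
    exact fun a ha => (mem_roots hp0).2 (hp a ha)

open Polynomial in
/-- A polynomial of degree less than `2 * N` vanishing at the Gauss nodes has integral zero. -/
lemma integral_eval_eq_zero {N : ℕ} {s : ℝ} {p : ℝ[X]}
    (hp : ∀ γ ∈ gaussNodes N s, p.eval γ = 0) (hdeg : p.natDegree < 2 * N) :
    ∫ x in (-s)..s, p.eval x = 0 := by
  obtain ⟨q, hq⟩ : legendre N ∣ p.comp (C s * X) := by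
    refine legendre_dvd fun a ha => ?_
    simpa using hp _ (Finset.mem_image.2 ⟨a, Multiset.mem_toFinset.2 ha, rfl⟩)
  have hqd : q.natDegree < N := by
    rcases eq_or_ne q 0 with rfl | hq0
    · simp only [natDegree_zero]; omega
    have h1 : (p.comp (C s * X)).natDegree ≤ p.natDegree := by
      rw [natDegree_comp]
      have h2 : (C s * X : ℝ[X]).natDegree ≤ 1 := by compute_degree
      nlinarith
    rw [hq, natDegree_mul (legendre_ne_zero N) hq0, natDegree_legendre] at h1
    omega
  have h := integral_legendre_mul_eq_zero hqd
  rw [← hq] at h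
  have h2 := intervalIntegral.smul_integral_comp_mul_left (a := -1) (b := 1)
    (fun x => p.eval x) s
  simp only [eval_comp, eval_mul, eval_C, eval_X] at h
  rw [h] at h2
  simpa using h2.symm

/-- The Lagrange basis polynomial `p` takes only the values 0 and 1 at the nodes, so `p² - p`
vanishes there and has degree below `2N`. Hence the weight equals `∫ p²`. Only here is exactness
beyond degree `N - 1` needed. -/
lemma gaussWeight_nonneg {N : ℕ} {s γ : ℝ} (hs : 0 < s) (hγ : γ ∈ gaussNodes N s) :
    0 ≤ gaussWeight N s γ := by
  set p := Lagrange.basis (gaussNodes N s) id γ with hp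
  have hdeg : p.natDegree = N - 1 := by
    refine Polynomial.natDegree_eq_of_degree_eq_some ?_
    rw [hp, Lagrange.degree_basis Function.injective_id.injOn hγ, card_gaussNodes N hs]
  have hN : 0 < N := by
    rw [← card_gaussNodes N hs]
    exact Finset.card_pos.2 ⟨γ, hγ⟩
  have h := integral_eval_eq_zero (N := N) (s := s) (p := p ^ 2 - p) (fun δ hδ => ?_) ?_
  · have h1 : gaussWeight N s γ = ∫ x in (-s)..s, (p.eval x) ^ 2 := by
      simp only [Polynomial.eval_sub, Polynomial.eval_pow] at h
      rw [intervalIntegral.integral_sub (Continuous.intervalIntegrable (by fun_prop) _ _)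
        (Continuous.intervalIntegrable (by fun_prop) _ _), sub_eq_zero] at h
      exact h.symm
    rw [h1]
    exact intervalIntegral.integral_nonneg (by linarith) fun x _ => sq_nonneg _
  · rcases eq_or_ne γ δ with rfl | hne
    · have := Lagrange.eval_basis_self (v := id) Function.injective_id.injOn hγ
      simp only [id] at this
      simp [hp, this]
    · have := Lagrange.eval_basis_of_ne (v := id) hne hδ
      simp only [id] at this
      simp [hp, this]
  · refine (Polynomial.natDegree_sub_le _ _).trans_lt (max_lt ?_ (by omega))
    refine Polynomial.natDegree_pow_le.trans_lt ?_
    omega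

open Polynomial in
lemma sum_gaussWeight_mul_eval {N : ℕ} {s : ℝ} (hs : 0 < s) {p : ℝ[X]} (hp : p.degree < N) :
    ∑ γ ∈ gaussNodes N s, gaussWeight N s γ * p.eval γ = ∫ x in (-s)..s, p.eval x := by
  have h := Lagrange.eq_interpolate (s := gaussNodes N s) (v := id) (f := p)
    Function.injective_id.injOn (by rwa [card_gaussNodes N hs])
  have h2 (x : ℝ) : p.eval x = ∑ γ ∈ gaussNodes N s,
      p.eval γ * (Lagrange.basis (gaussNodes N s) id γ).eval x := by
    conv_lhs => rw [h]
    simp [Lagrange.interpolate_apply, eval_finsetSum]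
  rw [intervalIntegral.integral_congr fun x _ => h2 x,
    intervalIntegral.integral_finsetSum fun γ _ => Continuous.intervalIntegrable (by fun_prop) _ _]
  refine Finset.sum_congr rfl fun γ _ => ?_
  rw [intervalIntegral.integral_const_mul, mul_comm]
  rfl

lemma sum_gaussWeight {N : ℕ} (hN : 1 ≤ N) {s : ℝ} (hs : 0 < s) :
    ∑ γ ∈ gaussNodes N s, gaussWeight N s γ = 2 * s := by
  have h := sum_gaussWeight_mul_eval (N := N) hs (p := 1)
    (by rw [Polynomial.degree_one]; exact_mod_cast hN)
  simp only [Polynomial.eval_one, mul_one, intervalIntegral.integral_const, smul_eq_mul] at h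
  rw [h]; ring

/-! ### Quadrature and cubature errors from polynomial approximation -/

open Polynomial in
/-- The error of Gauss quadrature is controlled by the distance to polynomials of small degree. -/
lemma abs_integral_sub_gauss_le {N : ℕ} (hN : 1 ≤ N) {s ε : ℝ} (hs : 0 < s) {h : ℝ → ℝ}
    (hc : Continuous h) {p : ℝ[X]} (hp : p.degree < N)
    (hε : ∀ x ∈ Set.Icc (-s) s, |h x - p.eval x| ≤ ε) :
    |(∫ x in (-s)..s, h x) - ∑ γ ∈ gaussNodes N s, gaussWeight N s γ * h γ| ≤ 4 * s * ε := by
  have h1 : |∫ x in (-s)..s, (h x - p.eval x)| ≤ 2 * s * ε := by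
    have := intervalIntegral.norm_integral_le_of_norm_le_const (a := -s) (b := s) (C := ε)
      (f := fun x => h x - p.eval x) (fun x hx => by
        rw [Set.uIoc_of_le (by linarith)] at hx
        exact hε x ⟨hx.1.le, hx.2⟩)
    rw [Real.norm_eq_abs, abs_of_nonneg (by linarith : 0 ≤ s - -s)] at this
    linarith
  have h2 : |∑ γ ∈ gaussNodes N s, gaussWeight N s γ * (h γ - p.eval γ)| ≤ 2 * s * ε := by
    rw [← sum_gaussWeight hN hs, Finset.sum_mul]
    refine (Finset.abs_sum_le_sum_abs _ _).trans (Finset.sum_le_sum fun γ hγ => ?_)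
    rw [abs_mul, abs_of_nonneg (gaussWeight_nonneg hs hγ)]
    exact mul_le_mul_of_nonneg_left (hε γ (mem_Icc_of_mem_gaussNodes hs hγ))
      (gaussWeight_nonneg hs hγ)
  have h3 : (∫ x in (-s)..s, h x) - ∑ γ ∈ gaussNodes N s, gaussWeight N s γ * h γ =
      (∫ x in (-s)..s, (h x - p.eval x)) -
        ∑ γ ∈ gaussNodes N s, gaussWeight N s γ * (h γ - p.eval γ) := by
    simp only [mul_sub, Finset.sum_sub_distrib]
    rw [sum_gaussWeight_mul_eval hs hp, intervalIntegral.integral_sub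
      (hc.intervalIntegrable _ _) (p.continuous.intervalIntegrable _ _)]
    ring
  rw [h3]
  exact (abs_sub _ _).trans (by linarith)

open Polynomial in
/-- The error of product Gauss cubature is controlled by the distance of the restrictions to
horizontal and vertical segments to polynomials of small degree. -/
lemma abs_cubatureError_le {N : ℕ} (hN : 1 ≤ N) {s ε : ℝ} (hs : 0 < s) {φ : ℝ × ℝ → ℝ}
    (hc : Continuous φ)
    (h₁ : ∀ y, ∃ p : ℝ[X], p.degree < N ∧ ∀ x ∈ Set.Icc (-s) s, |φ (x, y) - p.eval x| ≤ ε)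
    (h₂ : ∀ x, ∃ p : ℝ[X], p.degree < N ∧ ∀ y ∈ Set.Icc (-s) s, |φ (x, y) - p.eval y| ≤ ε) :
    |cubatureError N s φ| ≤ 16 * s ^ 2 * ε := by
  have hle : -s ≤ s := by linarith
  have e₁ (y : ℝ) : |(∫ x in (-s)..s, φ (x, y)) -
      ∑ γ ∈ gaussNodes N s, gaussWeight N s γ * φ (γ, y)| ≤ 4 * s * ε := by
    obtain ⟨p, hp, hε⟩ := h₁ y
    exact abs_integral_sub_gauss_le hN hs (h := fun x => φ (x, y)) (by fun_prop) hp hε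
  have e₂ (x : ℝ) : |(∫ y in (-s)..s, φ (x, y)) -
      ∑ γ ∈ gaussNodes N s, gaussWeight N s γ * φ (x, γ)| ≤ 4 * s * ε := by
    obtain ⟨p, hp, hε⟩ := h₂ x
    exact abs_integral_sub_gauss_le hN hs (h := fun y => φ (x, y)) (by fun_prop) hp hε
  have hG : Continuous fun y => ∫ x in (-s)..s, φ (x, y) :=
    intervalIntegral.continuous_parametric_intervalIntegral_of_continuous'
      (f := fun y x => φ (x, y)) (by simp only [Function.uncurry_def]; fun_prop) _ _
  have hint : IntegrableOn φ (Set.Icc (-s) s ×ˢ Set.Icc (-s) s) :=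
    hc.continuousOn.integrableOn_compact (isCompact_Icc.prod isCompact_Icc)
  have hI : ∫ p in centeredSquare s, φ p = ∫ x in (-s)..s, ∫ y in (-s)..s, φ (x, y) := by
    rw [centeredSquare, Measure.volume_eq_prod, setIntegral_prod _ hint]
    simp_rw [intervalIntegral.integral_of_le hle, integral_Icc_eq_integral_Ioc]
  have hswap : ∫ x in (-s)..s, ∫ y in (-s)..s, φ (x, y) =
      ∫ y in (-s)..s, ∫ x in (-s)..s, φ (x, y) := by
    refine intervalIntegral_intervalIntegral_swap (F := fun x y => φ (x, y)) ?_
    rw [Set.uIoc_of_le hle]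
    exact hint.mono_set (Set.prod_mono Set.Ioc_subset_Icc_self Set.Ioc_subset_Icc_self)
  have hS : ∑ l ∈ gaussNodes N s ×ˢ gaussNodes N s,
      φ l * (gaussWeight N s l.1 * gaussWeight N s l.2) =
      ∑ γ ∈ gaussNodes N s, gaussWeight N s γ *
        ∑ δ ∈ gaussNodes N s, gaussWeight N s δ * φ (γ, δ) := by
    rw [Finset.sum_product]
    refine Finset.sum_congr rfl fun γ _ => ?_
    rw [Finset.mul_sum]
    refine Finset.sum_congr rfl fun δ _ => ?_
    ring
  -- Insert the mixed term that applies the rule in `x` and the integral in `y`: the error splits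
  -- into the integrated `x`-errors and the weighted `y`-errors at the nodes.
  have hE : cubatureError N s φ =
      (∫ y in (-s)..s, ((∫ x in (-s)..s, φ (x, y)) -
        ∑ γ ∈ gaussNodes N s, gaussWeight N s γ * φ (γ, y))) +
      ∑ γ ∈ gaussNodes N s, gaussWeight N s γ * ((∫ y in (-s)..s, φ (γ, y)) -
        ∑ δ ∈ gaussNodes N s, gaussWeight N s δ * φ (γ, δ)) := by
    rw [cubatureError, hI, hS, hswap, intervalIntegral.integral_sub
      (hG.intervalIntegrable _ _) (Continuous.intervalIntegrable (by fun_prop) _ _),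
      intervalIntegral.integral_finsetSum
        fun γ _ => Continuous.intervalIntegrable (by fun_prop) _ _]
    simp_rw [intervalIntegral.integral_const_mul, mul_sub, Finset.sum_sub_distrib]
    ring
  have b₁ : |∫ y in (-s)..s, ((∫ x in (-s)..s, φ (x, y)) -
        ∑ γ ∈ gaussNodes N s, gaussWeight N s γ * φ (γ, y))| ≤ 4 * s * ε * (2 * s) := by
    have := intervalIntegral.norm_integral_le_of_norm_le_const (a := -s) (b := s)
      (C := 4 * s * ε) (f := fun y => (∫ x in (-s)..s, φ (x, y)) -
        ∑ γ ∈ gaussNodes N s, gaussWeight N s γ * φ (γ, y)) (fun y _ => e₁ y)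
    rw [Real.norm_eq_abs, abs_of_nonneg (by linarith : 0 ≤ s - -s)] at this
    linarith
  have b₂ : |∑ γ ∈ gaussNodes N s, gaussWeight N s γ * ((∫ y in (-s)..s, φ (γ, y)) -
        ∑ δ ∈ gaussNodes N s, gaussWeight N s δ * φ (γ, δ))| ≤ 2 * s * (4 * s * ε) := by
    rw [← sum_gaussWeight hN hs, Finset.sum_mul]
    refine (Finset.abs_sum_le_sum_abs _ _).trans (Finset.sum_le_sum fun γ hγ => ?_)
    rw [abs_mul, abs_of_nonneg (gaussWeight_nonneg hs hγ)]
    refine mul_le_mul_of_nonneg_left ?_ (gaussWeight_nonneg hs hγ)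
    exact e₂ γ
  rw [hE]
  refine (abs_add_le _ _).trans ((add_le_add b₁ b₂).trans (le_of_eq ?_))
  ring

/-! ### Taylor approximation of entire functions -/

open Polynomial in
/-- Taylor polynomials at the origin of a function that is bounded on a circle. -/
lemma exists_polynomial_near_re {h : ℂ → ℂ} (hd : Differentiable ℂ h) {R C s : ℝ}
    (hs : 0 ≤ s) (hsR : s < R) (hC : ∀ z, ‖z‖ = R → ‖h z‖ ≤ C) (N : ℕ) :
    ∃ p : ℝ[X], p.degree < N ∧
      ∀ x ∈ Set.Icc (-s) s, |(h x).re - p.eval x| ≤ C * (s / R) ^ N / (1 - s / R) := by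
  have hR : 0 < R := hs.trans_lt hsR
  have hC0 : 0 ≤ C := (norm_nonneg _).trans (hC R (by simp [hR.le]))
  set c : ℕ → ℂ := fun n => (n.factorial : ℂ)⁻¹ * iteratedDeriv n h 0 with hcdef
  -- Cauchy's estimate on the circle of radius `R`.
  have hcn (n : ℕ) : ‖c n‖ ≤ C / R ^ n := by
    have := Complex.norm_iteratedDeriv_le_of_forall_mem_sphere_norm_le n hR hd.diffContOnCl
      (c := 0) (C := C) (fun z hz => hC z (by simpa using hz))
    rw [hcdef, norm_mul, norm_inv, Complex.norm_natCast]
    rw [inv_mul_le_iff₀ (by positivity), ← mul_div_assoc]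
    exact this
  refine ⟨∑ n ∈ Finset.range N, Polynomial.C (c n).re * X ^ n, ?_, fun x hx => ?_⟩
  · refine (Polynomial.degree_lt_iff_coeff_zero _ _).2 fun m hm => ?_
    rw [finsetSum_coeff]
    refine Finset.sum_eq_zero fun n hn => ?_
    have : m ≠ n := by have := Finset.mem_range.1 hn; omega
    simp [coeff_C_mul, coeff_X_pow, this]
  · have hsum : HasSum (fun n => c n * (x : ℂ) ^ n) (h x) := by
      have := Complex.hasSum_taylorSeries_of_entire hd 0 x
      simp only [sub_zero, smul_eq_mul] at this
      convert! this using 2 with n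
      simp only [hcdef]; ring
    have hx' : |x| ≤ s := abs_le.2 hx
    have hb (n : ℕ) : ‖c n * (x : ℂ) ^ n‖ ≤ C * (s / R) ^ n := by
      rw [norm_mul, norm_pow, Complex.norm_real, Real.norm_eq_abs]
      calc ‖c n‖ * |x| ^ n ≤ C / R ^ n * s ^ n := by gcongr; exact hcn n
        _ = C * (s / R) ^ n := by rw [div_pow]; ring
    have h1 := norm_sub_le_of_geometric_bound_of_hasSum ((div_lt_one hR).2 hsR) hb hsum N
    -- For real `x`, taking real parts of the coefficients amounts to taking the real part of the
    -- partial sum.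
    have h2 : (h x).re - (∑ n ∈ Finset.range N, Polynomial.C (c n).re * X ^ n).eval x =
        -((∑ n ∈ Finset.range N, c n * (x : ℂ) ^ n) - h x).re := by
      rw [Complex.sub_re, Complex.re_sum, eval_finsetSum]
      have (n : ℕ) : (c n * (x : ℂ) ^ n).re = (c n).re * x ^ n := by
        rw [← Complex.ofReal_pow, Complex.re_mul_ofReal]
      simp [this]
    rw [h2, abs_neg]
    exact (Complex.abs_re_le_norm _).trans h1

/-! ### The Bargmann transform -/

/-- The kernel of the Bargmann transform. -/
def bargmannKernel (w : ℂ) (t : ℝ) : ℂ :=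
  Complex.exp (-Real.pi * (t : ℂ) ^ 2 + 2 * Real.pi * t * w)

/-- The Bargmann transform of `f`, without its Gaussian normalisation. -/
def bargmann (f : Lp ℂ 2 (volume : Measure ℝ)) (w : ℂ) : ℂ :=
  ∫ t : ℝ, f t * bargmannKernel w t

lemma continuous_bargmannKernel (w : ℂ) : Continuous (bargmannKernel w) := by
  unfold bargmannKernel; fun_prop

lemma norm_bargmannKernel (w : ℂ) (t : ℝ) :
    ‖bargmannKernel w t‖ = Real.exp (-Real.pi * t ^ 2 + 2 * Real.pi * t * w.re) := by
  have : -(Real.pi : ℂ) * (t : ℂ) ^ 2 + 2 * Real.pi * t * w =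
      ((-Real.pi * t ^ 2 : ℝ) : ℂ) + ((2 * Real.pi * t : ℝ) : ℂ) * w := by push_cast; ring
  rw [bargmannKernel, Complex.norm_exp, this, Complex.add_re, Complex.ofReal_re,
    Complex.re_ofReal_mul]

lemma norm_bargmannKernel_sq (w : ℂ) (t : ℝ) :
    ‖bargmannKernel w t‖ ^ 2 =
      Real.exp (2 * Real.pi * w.re ^ 2) * Real.exp (-(2 * Real.pi) * (t - w.re) ^ 2) := by
  rw [norm_bargmannKernel, ← Real.exp_nat_mul, ← Real.exp_add]
  congr 1
  push_cast; ring

lemma memLp_bargmannKernel (w : ℂ) : MemLp (bargmannKernel w) 2 (volume : Measure ℝ) := by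
  rw [memLp_two_iff_integrable_sq_norm (continuous_bargmannKernel w).aestronglyMeasurable]
  simp_rw [norm_bargmannKernel_sq]
  exact ((integrable_exp_neg_mul_sq (by positivity : 0 < 2 * Real.pi)).comp_sub_right w.re).const_mul _

lemma integral_norm_bargmannKernel_sq_le (w : ℂ) :
    ∫ t : ℝ, ‖bargmannKernel w t‖ ^ 2 ≤ Real.exp (2 * Real.pi * w.re ^ 2) := by
  simp_rw [norm_bargmannKernel_sq]
  rw [integral_const_mul,
    integral_sub_right_eq_self (fun t : ℝ => Real.exp (-(2 * Real.pi) * t ^ 2)) w.re,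
    integral_gaussian]
  refine mul_le_of_le_one_right (Real.exp_nonneg _) (Real.sqrt_le_one.2 ?_)
  rw [div_le_one (by positivity)]
  linarith [Real.pi_pos]

lemma integrable_mul_of_memLp (f : Lp ℂ 2 (volume : Measure ℝ)) {k : ℝ → ℂ} (hk : MemLp k 2) :
    Integrable fun t => f t * k t :=
  (Lp.memLp f).integrable_mul hk

lemma norm_Lp_two_eq (f : Lp ℂ 2 (volume : Measure ℝ)) :
    ‖f‖ = (∫ t, ‖f t‖ ^ (2 : ℝ)) ^ (1 / (2 : ℝ)) := by
  rw [Lp.norm_def, (Lp.memLp f).eLpNorm_eq_integral_rpow_norm (by norm_num) (by norm_num),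
    ENNReal.toReal_ofReal (by positivity)]
  simp

/-- Cauchy–Schwarz, with the `L²` norm of the kernel bounded by `exp(π (re w)²)`. -/
lemma norm_bargmann_le (f : Lp ℂ 2 (volume : Measure ℝ)) (w : ℂ) :
    ‖bargmann f w‖ ≤ ‖f‖ * Real.exp (Real.pi * w.re ^ 2) := by
  have h := integral_mul_norm_le_Lp_mul_Lq (μ := (volume : Measure ℝ)) (f := f)
    (g := bargmannKernel w) Real.HolderConjugate.two_two
    (by simpa using Lp.memLp f) (by simpa using memLp_bargmannKernel w)
  rw [← norm_Lp_two_eq] at h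
  have h2 : (∫ t : ℝ, ‖bargmannKernel w t‖ ^ (2 : ℝ)) ^ (1 / (2 : ℝ)) ≤
      Real.exp (Real.pi * w.re ^ 2) := by
    simp_rw [Real.rpow_two]
    rw [← Real.sqrt_eq_rpow]
    refine Real.sqrt_le_iff.2 ⟨Real.exp_nonneg _, ?_⟩
    rw [← Real.exp_nat_mul]
    convert! integral_norm_bargmannKernel_sq_le w using 2
    push_cast; ring
  calc ‖bargmann f w‖ ≤ ∫ t, ‖f t * bargmannKernel w t‖ := norm_integral_le_integral_norm _
    _ = ∫ t, ‖f t‖ * ‖bargmannKernel w t‖ := by simp_rw [norm_mul]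
    _ ≤ _ := h.trans (by gcongr)

/-- Domination for differentiating under the integral: `2π|t| ≤ exp(2π|t|)` absorbs the factor `t`
at the price of moving `re w` by one. The sign of `t` decides which of the two kernels dominates. -/
lemma norm_mul_bargmannKernel_le {w : ℂ} {A : ℝ} (hA : |w.re| + 1 ≤ A) (t : ℝ) :
    ‖2 * Real.pi * t * bargmannKernel w t‖ ≤
      ‖bargmannKernel (A : ℂ) t‖ + ‖bargmannKernel (-A : ℂ) t‖ := by
  have hpi := Real.pi_pos
  have key (u : ℝ) (hu : 0 ≤ u) (a : ℝ) (ha : a + 1 ≤ A) :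
      2 * Real.pi * u * Real.exp (-Real.pi * u ^ 2 + 2 * Real.pi * u * a) ≤
        Real.exp (-Real.pi * u ^ 2 + 2 * Real.pi * u * A) := by
    calc 2 * Real.pi * u * Real.exp (-Real.pi * u ^ 2 + 2 * Real.pi * u * a)
        ≤ Real.exp (2 * Real.pi * u) * Real.exp (-Real.pi * u ^ 2 + 2 * Real.pi * u * a) := by
          gcongr
          linarith [Real.add_one_le_exp (2 * Real.pi * u)]
      _ = Real.exp (-Real.pi * u ^ 2 + 2 * Real.pi * u * (a + 1)) := by
          rw [← Real.exp_add]; ring_nf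
      _ ≤ _ := by gcongr
  have hn : ‖2 * Real.pi * t * bargmannKernel w t‖ =
      2 * Real.pi * |t| * Real.exp (-Real.pi * t ^ 2 + 2 * Real.pi * t * w.re) := by
    rw [norm_mul, norm_bargmannKernel, norm_mul, norm_mul, Complex.norm_real, Complex.norm_real,
      Real.norm_eq_abs, Real.norm_eq_abs, abs_of_pos hpi]
    simp
  rw [hn, norm_bargmannKernel, norm_bargmannKernel, Complex.neg_re, Complex.ofReal_re]
  rcases le_total 0 t with ht | ht
  · have := key t ht w.re (by linarith [le_abs_self w.re])
    rw [abs_of_nonneg ht]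
    linarith [Real.exp_pos (-Real.pi * t ^ 2 + 2 * Real.pi * t * -A)]
  · have := key (-t) (by linarith) (-w.re) (by linarith [neg_abs_le w.re])
    rw [abs_of_nonpos ht]
    have e1 : -Real.pi * (-t) ^ 2 + 2 * Real.pi * -t * -w.re =
      -Real.pi * t ^ 2 + 2 * Real.pi * t * w.re := by ring
    have e2 : -Real.pi * (-t) ^ 2 + 2 * Real.pi * -t * A =
      -Real.pi * t ^ 2 + 2 * Real.pi * t * -A := by ring
    rw [e1, e2] at this
    linarith [Real.exp_pos (-Real.pi * t ^ 2 + 2 * Real.pi * t * A)]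

lemma hasDerivAt_bargmannKernel (w : ℂ) (t : ℝ) :
    HasDerivAt (fun w => bargmannKernel w t) (2 * Real.pi * t * bargmannKernel w t) w := by
  have h := (((hasDerivAt_id w).const_mul (2 * Real.pi * t : ℂ)).const_add
    (-Real.pi * (t : ℂ) ^ 2)).cexp
  simp only [id, mul_one] at h
  rw [mul_comm]
  exact h

/-- The Bargmann transform is entire. -/
lemma differentiable_bargmann (f : Lp ℂ 2 (volume : Measure ℝ)) :
    Differentiable ℂ (bargmann f) := by
  intro w₀
  have hm := Lp.aestronglyMeasurable f
  -- One unit for the radius of the ball around `w₀`, one for absorbing the factor `t`.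
  set A := |w₀.re| + 2 with hA
  have h := hasDerivAt_integral_of_dominated_loc_of_deriv_le (μ := (volume : Measure ℝ))
    (F := fun w t => f t * bargmannKernel w t)
    (F' := fun w t => f t * (2 * Real.pi * t * bargmannKernel w t))
    (bound := fun t => ‖f t‖ * (‖bargmannKernel (A : ℂ) t‖ + ‖bargmannKernel (-A : ℂ) t‖))
    (x₀ := w₀) (Metric.ball_mem_nhds w₀ one_pos)
    (Filter.Eventually.of_forall fun w =>
      hm.mul (continuous_bargmannKernel w).aestronglyMeasurable)
    (integrable_mul_of_memLp f (memLp_bargmannKernel w₀))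
    (hm.mul (Continuous.aestronglyMeasurable
      (by have := continuous_bargmannKernel w₀; fun_prop)))
    (Filter.Eventually.of_forall fun t w hw => ?_) ?_
    (Filter.Eventually.of_forall fun t w _ => (hasDerivAt_bargmannKernel w t).const_mul _)
  · exact h.2.differentiableAt
  · rw [norm_mul]
    refine mul_le_mul_of_nonneg_left (norm_mul_bargmannKernel_le ?_ t) (norm_nonneg _)
    have h1 : |(w - w₀).re| ≤ 1 :=
      (Complex.abs_re_le_norm _).trans (by simpa [dist_eq_norm] using (Metric.mem_ball.1 hw).le)
    have h2 : |w.re| ≤ |(w - w₀).re| + |w₀.re| := by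
      rw [Complex.sub_re]
      simpa using abs_add_le (w.re - w₀.re) w₀.re
    linarith
  · simp_rw [mul_add]
    have h1 := (integrable_mul_of_memLp f (memLp_bargmannKernel (A : ℂ))).norm
    have h2 := (integrable_mul_of_memLp f (memLp_bargmannKernel (-A : ℂ))).norm
    simp_rw [norm_mul] at h1 h2
    exact h1.add h2

/-! ### Entire extensions of the Gabor transform and the spectrogram -/

/-- The analytic extension of the Gabor transform to complex arguments. -/
def gaborExt (f : Lp ℂ 2 (volume : Measure ℝ)) (x y : ℂ) : ℂ :=
  Complex.exp (-Real.pi * x ^ 2) * bargmann f (x - Complex.I * y)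

/-- Expand `-π(t - x)² - 2πi t y = -πx² + (-πt² + 2πt(x - iy))`. -/
lemma gabor_eq_gaborExt (f : Lp ℂ 2 (volume : Measure ℝ)) (p : ℝ × ℝ) :
    gabor f p = gaborExt f p.1 p.2 := by
  rw [gabor, Real.fourier_real_eq_integral_exp_smul, gaborExt, bargmann, ← integral_const_mul]
  refine integral_congr_ae (Filter.Eventually.of_forall fun t => ?_)
  simp only [bargmannKernel, smul_eq_mul, Complex.ofReal_exp]
  rw [mul_left_comm, mul_left_comm (Complex.exp _) (f t), ← Complex.exp_add, ← Complex.exp_add]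
  congr 2
  push_cast
  ring

lemma continuous_gabor (f : Lp ℂ 2 (volume : Measure ℝ)) : Continuous (gabor f) := by
  have h := (differentiable_bargmann f).continuous
  have : gabor f = fun p => gaborExt f p.1 p.2 := funext (gabor_eq_gaborExt f)
  rw [this]
  unfold gaborExt
  fun_prop

/-- The exponent is `π` times `(im x)² - (re x)² + (re x + im y)²`. The cross term `2 re x im y`
depends on the position; it cancels in `norm_spectrogramLine_le`. -/
lemma norm_gaborExt_le (f : Lp ℂ 2 (volume : Measure ℝ)) (x y : ℂ) :
    ‖gaborExt f x y‖ ≤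
      ‖f‖ * Real.exp (Real.pi * (x.im ^ 2 + 2 * x.re * y.im + y.im ^ 2)) := by
  have h1 : ‖Complex.exp (-Real.pi * x ^ 2)‖ = Real.exp (-Real.pi * (x.re ^ 2 - x.im ^ 2)) := by
    rw [Complex.norm_exp, ← Complex.ofReal_neg, Complex.re_ofReal_mul]
    congr 2
    rw [sq, Complex.mul_re]; ring
  have h2 := norm_bargmann_le f (x - Complex.I * y)
  have h3 : (x - Complex.I * y).re = x.re + y.im := by simp
  rw [h3] at h2
  rw [gaborExt, norm_mul, h1]
  calc _ ≤ Real.exp (-Real.pi * (x.re ^ 2 - x.im ^ 2)) *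
        (‖f‖ * Real.exp (Real.pi * (x.re + y.im) ^ 2)) := by gcongr
    _ = _ := by
      rw [mul_left_comm, ← Real.exp_add]
      ring_nf

/-- The restriction of the extended Gabor transform to the complexification of the line
`t ↦ a + t • v`. -/
def gaborLine (f : Lp ℂ 2 (volume : Measure ℝ)) (a v : ℝ × ℝ) (z : ℂ) : ℂ :=
  gaborExt f (a.1 + z * v.1) (a.2 + z * v.2)

/-- The entire extension of the spectrogram along the line `t ↦ a + t • v`. -/
def spectrogramLine (f : Lp ℂ 2 (volume : Measure ℝ)) (a v : ℝ × ℝ) (z : ℂ) : ℂ :=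
  gaborLine f a v z * (starRingEnd ℂ) (gaborLine f a v ((starRingEnd ℂ) z))

lemma differentiable_spectrogramLine (f : Lp ℂ 2 (volume : Measure ℝ)) (a v : ℝ × ℝ) :
    Differentiable ℂ (spectrogramLine f a v) := by
  have h : Differentiable ℂ (gaborLine f a v) := by
    have := differentiable_bargmann f
    unfold gaborLine gaborExt
    fun_prop
  intro z
  refine (h z).mul ?_
  -- Conjugating both argument and value preserves holomorphy.
  have := (h ((starRingEnd ℂ) z)).conj_conj
  rwa [Complex.conj_conj] at this

lemma spectrogramLine_ofReal (f : Lp ℂ 2 (volume : Measure ℝ)) (a v : ℝ × ℝ) (t : ℝ) :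
    spectrogramLine f a v t = (spectrogram f (a + t • v) : ℂ) := by
  rw [spectrogramLine, Complex.conj_ofReal, Complex.mul_conj, Complex.normSq_eq_norm_sq,
    spectrogram, gabor_eq_gaborExt, gaborLine]
  simp

/-- At `z` and `conj z` the real parts agree and the imaginary parts are opposite, so the cross
terms cancel. The remaining squares add up to `2 (im z)² (v.1² + v.2²)`, independently of `a`. -/
lemma norm_spectrogramLine_le (f : Lp ℂ 2 (volume : Measure ℝ)) (a : ℝ × ℝ) {v : ℝ × ℝ}
    (hv : v.1 ^ 2 + v.2 ^ 2 = 1) (z : ℂ) :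
    ‖spectrogramLine f a v z‖ ≤ ‖f‖ ^ 2 * Real.exp (2 * Real.pi * z.im ^ 2) := by
  have hre (b c : ℝ) (z : ℂ) : (b + z * c : ℂ).re = b + z.re * c := by simp
  have him (b c : ℝ) (z : ℂ) : (b + z * c : ℂ).im = z.im * c := by simp
  have h1 := norm_gaborExt_le f (a.1 + z * v.1) (a.2 + z * v.2)
  have h2 := norm_gaborExt_le f (a.1 + (starRingEnd ℂ) z * v.1) (a.2 + (starRingEnd ℂ) z * v.2)
  rw [hre, him, him] at h1 h2
  rw [Complex.conj_re, Complex.conj_im] at h2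
  rw [spectrogramLine, norm_mul, Complex.norm_conj]
  calc _ ≤ _ := mul_le_mul h1 h2 (norm_nonneg _) (by positivity)
    _ = _ := by
      rw [mul_mul_mul_comm, ← Real.exp_add, sq ‖f‖]
      congr 2
      linear_combination 2 * Real.pi * z.im ^ 2 * hv

/-- The entire extension of `(𝒮 f - 𝒮 g) ^ 2` along a line has Gaussian growth in the imaginary
direction. -/
lemma norm_spectrogramLine_sub_sq_le (f g : Lp ℂ 2 (volume : Measure ℝ)) (a : ℝ × ℝ)
    {v : ℝ × ℝ} (hv : v.1 ^ 2 + v.2 ^ 2 = 1) (z : ℂ) :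
    ‖(spectrogramLine f a v z - spectrogramLine g a v z) ^ 2‖ ≤
      2 * (‖f‖ ^ 4 + ‖g‖ ^ 4) * Real.exp (4 * Real.pi * z.im ^ 2) := by
  have hf := norm_spectrogramLine_le f a hv z
  have hg := norm_spectrogramLine_le g a hv z
  have hs : ‖spectrogramLine f a v z - spectrogramLine g a v z‖ ≤
      (‖f‖ ^ 2 + ‖g‖ ^ 2) * Real.exp (2 * Real.pi * z.im ^ 2) := by
    rw [add_mul]
    exact (norm_sub_le _ _).trans (add_le_add hf hg)
  have he : Real.exp (4 * Real.pi * z.im ^ 2) = Real.exp (2 * Real.pi * z.im ^ 2) ^ 2 := by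
    rw [← Real.exp_nat_mul]; push_cast; ring_nf
  rw [norm_pow, he]
  calc _ ≤ ((‖f‖ ^ 2 + ‖g‖ ^ 2) * Real.exp (2 * Real.pi * z.im ^ 2)) ^ 2 := by gcongr
    _ = (‖f‖ ^ 2 + ‖g‖ ^ 2) ^ 2 * Real.exp (2 * Real.pi * z.im ^ 2) ^ 2 := by ring
    _ ≤ _ := by
      gcongr
      nlinarith [sq_nonneg (‖f‖ ^ 2 - ‖g‖ ^ 2)]

open Polynomial in
/-- Along lines, `(𝒮 f - 𝒮 g) ^ 2` is close to polynomials of degree less than `N`. -/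
lemma exists_polynomial_near_spectrogram (f g : Lp ℂ 2 (volume : Measure ℝ)) (a : ℝ × ℝ)
    {v : ℝ × ℝ} (hv : v.1 ^ 2 + v.2 ^ 2 = 1) {s R : ℝ} (hs : 0 ≤ s) (hsR : s < R) (N : ℕ) :
    ∃ p : ℝ[X], p.degree < N ∧ ∀ t ∈ Set.Icc (-s) s,
      |(spectrogram f (a + t • v) - spectrogram g (a + t • v)) ^ 2 - p.eval t| ≤
        2 * (‖f‖ ^ 4 + ‖g‖ ^ 4) * Real.exp (4 * Real.pi * R ^ 2) * (s / R) ^ N / (1 - s / R) := by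
  obtain ⟨p, hp, h⟩ := exists_polynomial_near_re
    (h := fun z => (spectrogramLine f a v z - spectrogramLine g a v z) ^ 2)
    (((differentiable_spectrogramLine f a v).sub (differentiable_spectrogramLine g a v)).pow 2)
    (C := 2 * (‖f‖ ^ 4 + ‖g‖ ^ 4) * Real.exp (4 * Real.pi * R ^ 2)) hs hsR (fun z hz => by
      refine (norm_spectrogramLine_sub_sq_le f g a hv z).trans ?_
      have : z.im ^ 2 ≤ R ^ 2 := by
        rw [← hz, ← sq_abs z.im]
        have := Complex.abs_im_le_norm z
        gcongr
      gcongr) N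
  refine ⟨p, hp, fun t ht => ?_⟩
  have := h t ht
  rwa [spectrogramLine_ofReal, spectrogramLine_ofReal, ← Complex.ofReal_sub, ← Complex.ofReal_pow,
    Complex.ofReal_re] at this

/-- The growth bound at `z = 0`; it handles the range of `N` where Taylor approximation is not used.
-/
lemma sq_spectrogram_sub_le (f g : Lp ℂ 2 (volume : Measure ℝ)) (p : ℝ × ℝ) :
    (spectrogram f p - spectrogram g p) ^ 2 ≤ 2 * (‖f‖ ^ 4 + ‖g‖ ^ 4) := by
  have h := norm_spectrogramLine_sub_sq_le f g p (v := (1, 0)) (by norm_num) ((0 : ℝ) : ℂ)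
  rw [spectrogramLine_ofReal, spectrogramLine_ofReal, ← Complex.ofReal_sub, ← Complex.ofReal_pow,
    Complex.norm_real] at h
  simpa using h

lemma continuous_rigidMotion (c : ℝ × ℝ) (θ : ℝ) : Continuous (rigidMotion c θ) := by
  unfold rigidMotion; fun_prop

open Polynomial in
/-- If `(𝒮 f - 𝒮 g) ^ 2` is close to polynomials of degree less than `N` along all lines, then the
cubature error on a square is small. -/
lemma abs_squareCubatureError_le {N : ℕ} (hN : 1 ≤ N) {r ε : ℝ} (hr : 0 < r) (c : ℝ × ℝ) (θ : ℝ)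
    {f g : Lp ℂ 2 (volume : Measure ℝ)}
    (h : ∀ a v : ℝ × ℝ, v.1 ^ 2 + v.2 ^ 2 = 1 → ∃ p : ℝ[X], p.degree < N ∧
      ∀ t ∈ Set.Icc (-r) r,
        |(spectrogram f (a + t • v) - spectrogram g (a + t • v)) ^ 2 - p.eval t| ≤ ε) :
    |squareCubatureError N r c θ (fun p => (spectrogram f p - spectrogram g p) ^ 2)| ≤
      16 * r ^ 2 * ε := by
  have hcont : Continuous ((fun p => (spectrogram f p - spectrogram g p) ^ 2) ∘
      rigidMotion c θ) := by
    refine Continuous.comp ?_ (continuous_rigidMotion c θ)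
    have := continuous_gabor f
    have := continuous_gabor g
    unfold spectrogram
    fun_prop
  refine abs_cubatureError_le hN hr hcont (fun y => ?_) (fun x => ?_)
  · obtain ⟨p, hp, hε⟩ := h (c.1 - Real.sin θ * y, c.2 + Real.cos θ * y)
      (Real.cos θ, Real.sin θ) (Real.cos_sq_add_sin_sq θ)
    refine ⟨p, hp, fun x hx => ?_⟩
    have e : rigidMotion c θ (x, y) = (c.1 - Real.sin θ * y, c.2 + Real.cos θ * y) +
        x • (Real.cos θ, Real.sin θ) := by
      ext <;> simp [rigidMotion] <;> ring
    simpa only [Function.comp_apply, e] using hε x hx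
  · obtain ⟨p, hp, hε⟩ := h (c.1 + Real.cos θ * x, c.2 + Real.sin θ * x)
      (-Real.sin θ, Real.cos θ) (by simp)
    refine ⟨p, hp, fun y hy => ?_⟩
    have e : rigidMotion c θ (x, y) = (c.1 + Real.cos θ * x, c.2 + Real.sin θ * x) +
        y • (-Real.sin θ, Real.cos θ) := by
      ext <;> simp [rigidMotion] <;> ring
    simpa only [Function.comp_apply, e] using hε y hy

/-! ### Choice of the radius and final estimate -/

/-- Isolates an `N`-th power, to be compared with 1 or with the Taylor error `(d s E / b)^N` of the
main proof. -/
lemma rpow_mul_exp_half_eq {N : ℕ} (hN : 1 ≤ N) (a : ℝ) :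
    3 * (a + 2) ^ (N + 3) * (N : ℝ) ^ (-((N : ℝ) - 1) / 2) * Real.exp ((N : ℝ) / 2) =
      3 * (a + 2) ^ 3 * Real.sqrt N *
        ((a + 2) * Real.exp (1 / 2) / Real.sqrt N) ^ N := by
  have hN0 : (0 : ℝ) < N := by exact_mod_cast hN
  have h1 : (N : ℝ) ^ (-((N : ℝ) - 1) / 2) = Real.sqrt N / Real.sqrt N ^ N := by
    rw [← Real.rpow_natCast (Real.sqrt N) N, Real.sqrt_eq_rpow, ← Real.rpow_mul hN0.le,
      ← Real.rpow_sub hN0]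
    ring_nf
  have h2 : Real.exp ((N : ℝ) / 2) = Real.exp (1 / 2) ^ N := by
    rw [← Real.exp_nat_mul]; ring_nf
  rw [h1, h2, div_pow, mul_pow]
  ring

end GaborCubature

end

theorem proposition3p3 (s : ℝ) (r : ℝ) (hr : 0 < r) (hrs : r ≤ s) (c : ℝ × ℝ) (θ : ℝ)
    (N : ℕ) (hN : 1 ≤ N) (f g : MeasureTheory.Lp ℂ 2 (MeasureTheory.volume : MeasureTheory.Measure ℝ)) :
    |GaborCubature.squareCubatureError N r c θ
        (fun p => (GaborCubature.spectrogram f p - GaborCubature.spectrogram g p) ^ 2)| ≤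
      3 * (Real.sqrt (8 * Real.pi) * s + 2) ^ (N + 3) * (N : ℝ) ^ (-((N : ℝ) - 1) / 2) *
        Real.exp ((N : ℝ) / 2) * (‖f‖ ^ 4 + ‖g‖ ^ 4) := by
  have hs : 0 < s := hr.trans_le hrs
  have hpi := Real.pi_gt_three
  have hK : 0 ≤ ‖f‖ ^ 4 + ‖g‖ ^ 4 := by positivity
  set K := ‖f‖ ^ 4 + ‖g‖ ^ 4 with hKdef
  rw [GaborCubature.rpow_mul_exp_half_eq hN]
  have hN1 : (1 : ℝ) ≤ N := by exact_mod_cast hN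
  have hb1 : 1 ≤ Real.sqrt N := Real.one_le_sqrt.2 hN1
  have hb2 : Real.sqrt N ^ 2 = N := Real.sq_sqrt (by linarith)
  have hd : 0 < Real.sqrt (8 * Real.pi) := Real.sqrt_pos.2 (by positivity)
  have hd2 : Real.sqrt (8 * Real.pi) ^ 2 = 8 * Real.pi := Real.sq_sqrt (by positivity)
  set b := Real.sqrt N with hb
  set d := Real.sqrt (8 * Real.pi) with hddef
  set E := Real.exp (1 / 2) with hE
  have hE0 : 0 < E := Real.exp_pos _
  have ha0 : 0 < d * s := by positivity
  -- Uses `8π ≥ 24`: the factors `16 r² * 6` below become at most `4 (d s)²`.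
  have ha2 : 24 * s ^ 2 ≤ (d * s) ^ 2 := by
    rw [mul_pow, hd2]; nlinarith [sq_nonneg s]
  have hr2 : r ^ 2 ≤ s ^ 2 := by gcongr
  have hcube : 4 * (d * s) ^ 2 ≤ 3 * (d * s + 2) ^ 3 := by
    have : 0 < (d * s) ^ 3 := by positivity
    nlinarith [sq_nonneg (d * s)]
  -- For `b ≤ d s E` the `N`-th power in the target is at least 1, and approximation by the zero
  -- polynomial is enough.
  rcases le_or_gt b (d * s * E) with hcase | hcase
  · have h1 := GaborCubature.abs_squareCubatureError_le hN hr c θ (f := f) (g := g) (ε := 2 * K)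
      (fun a v _ => ⟨0, by simp, fun t _ => by
        rw [Polynomial.eval_zero, sub_zero, abs_of_nonneg (sq_nonneg _)]
        exact GaborCubature.sq_spectrogram_sub_le f g _⟩)
    have hpow : 1 ≤ ((d * s + 2) * E / b) ^ N := by
      refine one_le_pow₀ ((one_le_div (by linarith)).2 ?_)
      nlinarith
    calc _ ≤ 16 * r ^ 2 * (2 * K) := h1
      _ ≤ (4 * (d * s) ^ 2) * 1 * 1 * K := by nlinarith
      _ ≤ _ := by gcongr
  -- Here `s / R = d s / b < 1 / E ≤ 2/3` for `R = b / d`, so `1 / (1 - s/R)` is at most 3. This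
  -- turns the constant 2 into the 6 of `ε`.
  · have hq : d * s / b < 2 / 3 := by
      have h32 : 3 / 2 ≤ E := by
        have := Real.add_one_le_exp (1 / 2 : ℝ)
        linarith
      rw [div_lt_iff₀ (by linarith)]
      nlinarith
    have hR : s < b / d := by
      rw [lt_div_iff₀ hd]
      have : d * s < 2 / 3 * b := (div_lt_iff₀ (by linarith)).1 hq
      linarith
    have hsR : s / (b / d) = d * s / b := by rw [div_div_eq_mul_div, mul_comm]
    -- With `R² = N/(8π)` the growth factor is exactly `e^(N/2)`.
    have hexp : Real.exp (4 * Real.pi * (b / d) ^ 2) = E ^ N := by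
      rw [div_pow, hb2, hd2, hE, ← Real.exp_nat_mul]
      congr 1
      field_simp
      norm_num
    have h1 := GaborCubature.abs_squareCubatureError_le hN hr c θ (f := f) (g := g)
      (ε := 6 * K * (d * s * E / b) ^ N) (fun a v hv => by
        obtain ⟨p, hp, h⟩ :=
          GaborCubature.exists_polynomial_near_spectrogram f g a hv hs.le hR N
        refine ⟨p, hp, fun t ht => (h t ⟨by linarith [ht.1], ht.2.trans hrs⟩).trans ?_⟩
        rw [hsR, hexp, ← hKdef, div_le_iff₀ (by linarith)]
        have e : (d * s * E / b) ^ N = E ^ N * (d * s / b) ^ N := by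
          rw [← mul_pow]; ring
        rw [e]
        have h0 : 0 ≤ K * (E ^ N * (d * s / b) ^ N) := by positivity
        nlinarith)
    calc _ ≤ 16 * r ^ 2 * (6 * K * (d * s * E / b) ^ N) := h1
      _ ≤ (4 * (d * s) ^ 2) * 1 * (d * s * E / b) ^ N * K := by
        have h0 : 0 ≤ K * (d * s * E / b) ^ N := by positivity
        nlinarith
      _ ≤ _ := by
        gcongr
        linarith
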